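/- **Corollary 2.6.** For a measurable function $f$ on $\mathbb{R}^2$ and $1\le p\le\infty$ put $$\big\|\,\|f\|_{L^p_x}\big\|_{L^\infty_y}=\operatorname*{ess\,sup}_{y\in\mathbb{R}}\|f(\cdot,y)\|_{L^p(\mathbb{R})},\qquad \big\|\,\|f\|_{L^\infty_y}\big\|_{L^p_x}=\big\|\,x\mapsto\operatorname*{ess\,sup}_{y\in\mathbb{R}}|f(x,y)|\,\big\|_{L^p(\mathbb{R})}.$$ Let $2\le p\le\infty$. Then there is no finite constant $C_p\ge 0$ such that $$\big\|\,\|\partial_x\partial_y u\|_{L^p_x}\big\|_{L^\infty_y}\le C_p\,\big\|\,\|\Delta u\|_{L^\infty_y}\big\|_{L^p_x}$$ for all Schwartz functions $u$ on $\mathbb{R}^2$, where $\Delta=\partial_x^2+\partial_y^2$. This holds both for complex-valued and for real-valued Schwartz functions $u$. -/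

import Mathlib

open MeasureTheory
open scoped ENNReal NNReal SchwartzMap LineDeriv Laplacian

/-- The mixed norm `‖ ‖f(x, y)‖_{L^p_x} ‖_{L^∞_y}` of a function on the plane: the `L^p` norm in the
first variable is taken first, then the essential supremum over the second variable. -/
noncomputable def normLinftyYLpX {F : Type*} [NormedAddCommGroup F] (p : ℝ≥0∞)
    (f : EuclideanSpace ℝ (Fin 2) → F) : ℝ≥0∞ :=
  eLpNorm (fun y : ℝ => eLpNorm (fun x : ℝ => f !₂[x, y]) p volume) ∞ volume

/-- The mixed norm `‖ ‖f(x, y)‖_{L^∞_y} ‖_{L^p_x}` of a function on the plane: the essential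
supremum over the second variable is taken first, then the `L^p` norm in the first variable. -/
noncomputable def normLpXLinftyY {F : Type*} [NormedAddCommGroup F] (p : ℝ≥0∞)
    (f : EuclideanSpace ℝ (Fin 2) → F) : ℝ≥0∞ :=
  eLpNorm (fun x : ℝ => eLpNorm (fun y : ℝ => f !₂[x, y]) ∞ volume) p volume

/-! The obstruction is that `∂_x ∂_y Δ⁻¹` is unbounded on `L^∞`-type spaces. Take `u_N = φ(x)
∑_{k<N} 4^{-k} cos(2^k x) ψ(2^k y)` with `φ` a cutoff and `ψ` an odd-type bump equal to `t` near
`0`. Near `y = 0` and where `φ = 1`, the mixed derivative is `-∑ sin(2^k x)`, whose `L²` norm over a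
period is `√(Nπ)` by orthogonality (`eLpNorm_two_lacunarySin_sq`); since `p ≥ 2`, its `L^p` norm
also grows. In the Laplacian the leading terms are `φ cos(2^k x) (ψ'' - ψ)(2^k y)`. As `ψ'' - ψ`
vanishes linearly at `0` and has bounded support, their sum is bounded uniformly in `N` and `y`
(`sum_dyadic_dilates_le`). Terms with derivatives of `φ` gain `2^{-k}`. Hence `|Δ u_N|` has a
majorant `G(x)` independent of `N` (`exists_lacunary_schwartzMap`). -/

theorem lineDeriv_fst_apply {𝕜 : Type*} [RCLike 𝕜] {f : 𝓢(EuclideanSpace ℝ (Fin 2), 𝕜)}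
    {F F' : ℝ → ℝ → ℝ} (hf : ∀ v, f v = (F (v 0) (v 1) : 𝕜))
    (hF : ∀ x y, HasDerivAt (fun t => F t y) (F' x y) x) (v : EuclideanSpace ℝ (Fin 2)) :
    (∂_{(EuclideanSpace.single 0 1 : EuclideanSpace ℝ (Fin 2))} f) v = (F' (v 0) (v 1) : 𝕜) := by
  rw [SchwartzMap.lineDerivOp_apply]
  refine HasLineDerivAt.lineDeriv ?_
  unfold HasLineDerivAt
  simp only [hf]
  have h1 : HasDerivAt (fun t => F t (v 1)) (F' (v 0) (v 1)) (v 0 + 0) := by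
    simpa using hF (v 0) (v 1)
  have h2 := (RCLike.ofRealCLM (K := 𝕜)).hasFDerivAt.comp_hasDerivAt (0 : ℝ)
    (h1.comp_const_add (v 0) 0)
  simpa [Function.comp_def] using h2

theorem lineDeriv_snd_apply {𝕜 : Type*} [RCLike 𝕜] {f : 𝓢(EuclideanSpace ℝ (Fin 2), 𝕜)}
    {F F' : ℝ → ℝ → ℝ} (hf : ∀ v, f v = (F (v 0) (v 1) : 𝕜))
    (hF : ∀ x y, HasDerivAt (fun t => F x t) (F' x y) y) (v : EuclideanSpace ℝ (Fin 2)) :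
    (∂_{(EuclideanSpace.single 1 1 : EuclideanSpace ℝ (Fin 2))} f) v = (F' (v 0) (v 1) : 𝕜) := by
  rw [SchwartzMap.lineDerivOp_apply]
  refine HasLineDerivAt.lineDeriv ?_
  unfold HasLineDerivAt
  simp only [hf]
  have h1 : HasDerivAt (fun t => F (v 0) t) (F' (v 0) (v 1)) (v 1 + 0) := by
    simpa using hF (v 0) (v 1)
  have h2 := (RCLike.ofRealCLM (K := 𝕜)).hasFDerivAt.comp_hasDerivAt (0 : ℝ)
    (h1.comp_const_add (v 1) 0)
  simpa [Function.comp_def] using h2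

theorem exists_schwartzMap_eq_of_contDiff (𝕜 : Type*) [RCLike 𝕜] {F : ℝ → ℝ → ℝ}
    (hF : ContDiff ℝ (⊤ : ℕ∞) (fun q : ℝ × ℝ => F q.1 q.2)) {R : ℝ}
    (hx : ∀ x y, R ≤ |x| → F x y = 0) (hy : ∀ x y, R ≤ |y| → F x y = 0) :
    ∃ f : 𝓢(EuclideanSpace ℝ (Fin 2), 𝕜), ∀ v, f v = (F (v 0) (v 1) : 𝕜) := by
  let g : EuclideanSpace ℝ (Fin 2) → 𝕜 := fun v => (F (v 0) (v 1) : 𝕜)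
  have h1 : HasCompactSupport g := by
    refine HasCompactSupport.intro (isCompact_closedBall 0 (R + R)) fun v hv => ?_
    by_contra hne
    have hx' : |v 0| < R := by
      by_contra h
      exact hne (by simp [g, hx (v 0) (v 1) (not_lt.1 h)])
    have hy' : |v 1| < R := by
      by_contra h
      exact hne (by simp [g, hy (v 0) (v 1) (not_lt.1 h)])
    apply hv
    rw [mem_closedBall_zero_iff, EuclideanSpace.norm_eq]
    refine Real.sqrt_le_iff.2 ⟨by linarith [abs_nonneg (v 0)], ?_⟩
    simp only [Fin.sum_univ_two, Real.norm_eq_abs]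
    nlinarith [abs_nonneg (v 0), abs_nonneg (v 1)]
  have h2 : ContDiff ℝ (⊤ : ℕ∞) g := by
    have : ContDiff ℝ (⊤ : ℕ∞) fun v : EuclideanSpace ℝ (Fin 2) => F (v 0) (v 1) :=
      hF.comp (f := fun v : EuclideanSpace ℝ (Fin 2) => (v 0, v 1)) (by fun_prop)
    exact (RCLike.ofRealCLM (K := 𝕜)).contDiff.comp this
  exact ⟨h1.toSchwartzMap h2, fun v => rfl⟩

theorem laplacian_apply_eq_lineDeriv {𝕜 : Type*} [RCLike 𝕜]
    (f : 𝓢(EuclideanSpace ℝ (Fin 2), 𝕜)) (v : EuclideanSpace ℝ (Fin 2)) :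
    (Δ f) v =
      (∂_{(EuclideanSpace.single 0 1 : EuclideanSpace ℝ (Fin 2))}
        (∂_{(EuclideanSpace.single 0 1 : EuclideanSpace ℝ (Fin 2))} f)) v +
      (∂_{(EuclideanSpace.single 1 1 : EuclideanSpace ℝ (Fin 2))}
        (∂_{(EuclideanSpace.single 1 1 : EuclideanSpace ℝ (Fin 2))} f)) v := by
  rw [SchwartzMap.laplacian_eq_sum (EuclideanSpace.basisFun (Fin 2) ℝ)]
  simp [Fin.sum_univ_two]

/-! ### Orthogonality and lacunary sine sums -/

theorem integral_sin_mul_sin_zero_two_pi {m n : ℕ} (hm : 0 < m) :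
    ∫ x in (0 : ℝ)..2 * Real.pi, Real.sin (m * x) * Real.sin (n * x) =
      if m = n then Real.pi else 0 := by
  have key (l : ℤ) : ∫ x in (0 : ℝ)..2 * Real.pi, Real.cos (l * x) =
      if l = 0 then 2 * Real.pi else 0 := by
    split_ifs with h
    · simp [h]
    · have h' : (l : ℝ) ≠ 0 := by exact_mod_cast h
      rw [intervalIntegral.integral_comp_mul_left _ h', integral_cos]
      have : Real.sin (l * (2 * Real.pi)) = 0 := by
        have := Real.sin_int_mul_pi (2 * l)
        push_cast at this
        rwa [mul_right_comm, mul_comm, mul_comm (l : ℝ)] at *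
      simp [this]
  have hsum (x : ℝ) : Real.sin (m * x) * Real.sin (n * x) =
      (1 / 2) * (Real.cos (((m - n : ℤ) : ℝ) * x) - Real.cos (((m + n : ℤ) : ℝ) * x)) := by
    push_cast
    rw [sub_mul, add_mul, Real.cos_sub, Real.cos_add]
    ring
  simp only [hsum]
  rw [intervalIntegral.integral_const_mul, intervalIntegral.integral_sub
    (Continuous.intervalIntegrable (by fun_prop) _ _)
    (Continuous.intervalIntegrable (by fun_prop) _ _), key, key]
  -- Only `m` need be positive: this already kills the integral of `cos ((m + n) x)`.
  have : (m + n : ℤ) ≠ 0 := by omega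
  have h3 : (m - n : ℤ) = 0 ↔ m = n := by omega
  simp only [this, h3, if_false]
  split_ifs <;> ring

/-- The lacunary sine sum `∑ sin (2 ^ k x)`. -/
noncomputable def lacunarySin (N : ℕ) (x : ℝ) : ℝ := ∑ k ∈ Finset.range N, Real.sin (2 ^ k * x)

theorem continuous_lacunarySin (N : ℕ) : Continuous (lacunarySin N) := by
  unfold lacunarySin; fun_prop

theorem integral_lacunarySin_sq (N : ℕ) :
    ∫ x in (0 : ℝ)..2 * Real.pi, lacunarySin N x ^ 2 = N * Real.pi := by
  have h (j k : ℕ) : ∫ x in (0 : ℝ)..2 * Real.pi, Real.sin (2 ^ j * x) * Real.sin (2 ^ k * x) =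
      if j = k then Real.pi else 0 := by
    have := integral_sin_mul_sin_zero_two_pi (m := 2 ^ j) (n := 2 ^ k) (by positivity)
    simpa using this
  simp only [lacunarySin, sq, Finset.sum_mul_sum]
  rw [intervalIntegral.integral_finsetSum
    fun i _ => Continuous.intervalIntegrable (by fun_prop) _ _]
  have : ∀ i ∈ Finset.range N, ∫ x in (0 : ℝ)..2 * Real.pi,
      ∑ j ∈ Finset.range N, Real.sin (2 ^ i * x) * Real.sin (2 ^ j * x) = Real.pi := by
    intro i hi
    rw [intervalIntegral.integral_finsetSum
      fun i _ => Continuous.intervalIntegrable (by fun_prop) _ _]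
    simp only [h]
    simpa using fun h : N ≤ i => absurd (Finset.mem_range.1 hi) (not_lt.2 h)
  rw [Finset.sum_congr rfl this]
  simp

theorem eLpNorm_two_lacunarySin_sq (N : ℕ) :
    eLpNorm (lacunarySin N) 2 (volume.restrict (Set.Ioc 0 (2 * Real.pi))) ^ 2 =
      ENNReal.ofReal (N * Real.pi) := by
  have h := eLpNorm_nnreal_pow_eq_lintegral (f := lacunarySin N) (p := 2)
    (μ := volume.restrict (Set.Ioc 0 (2 * Real.pi))) two_ne_zero
  rw [← integral_lacunarySin_sq, intervalIntegral.integral_of_le (by positivity),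
    ofReal_integral_eq_lintegral_ofReal]
  · have h2 : ((2 : ℝ≥0) : ℝ) = ((2 : ℕ) : ℝ) := by norm_num
    rw [h2, ENNReal.rpow_natCast] at h
    simp only [ENNReal.rpow_natCast] at h
    refine h.trans (lintegral_congr fun x => ?_)
    rw [Real.enorm_eq_ofReal_abs, ← ENNReal.ofReal_pow (abs_nonneg _), sq_abs]
  · exact (((continuous_lacunarySin N).pow 2).integrableOn_Icc).mono_set Set.Ioc_subset_Icc_self
  · exact Filter.Eventually.of_forall fun x => sq_nonneg _

/-! ### Cutoffs, the profile and its dyadic dilates -/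

theorem exists_contDiff_cutoff {r R : ℝ} (hr : 0 < r) (hR : r < R) :
    ∃ φ : ℝ → ℝ, ContDiff ℝ (⊤ : ℕ∞) φ ∧ (∀ x, |x| ≤ r → φ x = 1) ∧ ∀ x, R ≤ |x| → φ x = 0 := by
  let b : ContDiffBump (0 : ℝ) := ⟨r, R, hr, hR⟩
  refine ⟨b, b.contDiff, fun x hx => b.one_of_mem_closedBall (by simpa using hx), fun x hx =>
    b.zero_of_le_dist (by simpa using hx)⟩

/-- Take `ψ t = t χ t` with `χ` a cutoff. Near `0` this gives `ψ'' - ψ = -t`, the source of the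
linear bound; away from `0` boundedness suffices. -/
theorem exists_odd_profile : ∃ ψ ψ₁ ψ₂ : ℝ → ℝ, ∃ B C : ℝ, ContDiff ℝ (⊤ : ℕ∞) ψ ∧
    (∀ t, HasDerivAt ψ (ψ₁ t) t) ∧ (∀ t, HasDerivAt ψ₁ (ψ₂ t) t) ∧
    (∀ t, |t| < 1 → ψ₁ t = 1) ∧ (∀ t, 2 ≤ |t| → ψ t = 0) ∧ (∀ t, |ψ t| ≤ B) ∧
    (∀ t, |ψ₂ t - ψ t| ≤ C * |t|) ∧ ∀ t, 2 < |t| → ψ₂ t - ψ t = 0 := by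
  obtain ⟨χ, hχ, hχ1, hχ0⟩ := exists_contDiff_cutoff one_pos one_lt_two
  let ψ : ℝ → ℝ := fun t => t * χ t
  have hψ : ContDiff ℝ (⊤ : ℕ∞) ψ := contDiff_id.mul hχ
  have hψ' : ContDiff ℝ (⊤ : ℕ∞) (deriv ψ) := (contDiff_infty_iff_deriv.1 hψ).2
  have hψ'' : ContDiff ℝ (⊤ : ℕ∞) (deriv (deriv ψ)) := (contDiff_infty_iff_deriv.1 hψ').2
  have hd : Differentiable ℝ ψ := hψ.differentiable (by simp)
  have hd' : Differentiable ℝ (deriv ψ) := hψ'.differentiable (by simp)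
  have hψ0 (t : ℝ) (ht : 2 ≤ |t|) : ψ t = 0 := by simp [ψ, hχ0 t ht]
  have hcs : HasCompactSupport ψ := by
    refine HasCompactSupport.intro (isCompact_closedBall (0 : ℝ) 2) fun t ht => hψ0 t ?_
    simpa using (lt_of_not_ge fun h => ht (by simpa using h)).le
  have hopen : IsOpen {t : ℝ | |t| < 1} := isOpen_lt continuous_abs continuous_const
  have hnear (t : ℝ) (ht : |t| < 1) : deriv ψ t = 1 := by
    have : ψ =ᶠ[nhds t] id := Filter.eventuallyEq_of_mem (hopen.mem_nhds ht) fun s hs => by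
      simp [ψ, hχ1 s (le_of_lt hs)]
    rw [this.deriv_eq, deriv_id]
  have hnear' (t : ℝ) (ht : |t| < 1) : deriv (deriv ψ) t = 0 := by
    have : deriv ψ =ᶠ[nhds t] fun _ => 1 :=
      Filter.eventuallyEq_of_mem (hopen.mem_nhds ht) fun s hs => hnear s hs
    rw [this.deriv_eq, deriv_const]
  have hfar (t : ℝ) (ht : 2 < |t|) : deriv (deriv ψ) t = 0 := by
    have : ψ =ᶠ[nhds t] fun _ => 0 := Filter.eventuallyEq_of_mem
      ((isOpen_lt continuous_const continuous_abs).mem_nhds ht) fun s hs => hψ0 s (le_of_lt hs)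
    rw [this.deriv.deriv_eq]
    simp
  obtain ⟨B, hB⟩ := hcs.exists_bound_of_continuous hψ.continuous
  obtain ⟨M, hM⟩ := (hcs.deriv.deriv.sub hcs).exists_bound_of_continuous
    (hψ''.continuous.sub hψ.continuous)
  refine ⟨ψ, deriv ψ, deriv (deriv ψ), B, max 1 M, hψ, fun t => (hd t).hasDerivAt,
    fun t => (hd' t).hasDerivAt, hnear, hψ0, hB, fun t => ?_, fun t ht => ?_⟩
  · rcases lt_or_ge |t| 1 with ht | ht
    · rw [hnear' t ht, zero_sub, abs_neg]
      have : ψ t = t := by simp [ψ, hχ1 t ht.le]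
      rw [this]
      exact le_mul_of_one_le_left (abs_nonneg t) (le_max_left _ _)
    · calc |deriv (deriv ψ) t - ψ t| ≤ M := hM t
        _ ≤ max 1 M := le_max_right _ _
        _ ≤ max 1 M * |t| := le_mul_of_one_le_right (by positivity) ht
  · rw [hfar t ht, hψ0 t ht.le, sub_zero]

/-- If the last dilate `2 ^ N * y` leaves the support, its term drops out and induction applies.
Otherwise the linear bound gives a geometric sum, at most `2 * 2 ^ N * C * |y| ≤ 4 * C`. -/
theorem sum_dyadic_dilates_le {h : ℝ → ℝ} {C : ℝ} (h1 : ∀ t, |h t| ≤ C * |t|)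
    (h2 : ∀ t, 2 < |t| → h t = 0) (N : ℕ) (y : ℝ) :
    ∑ k ∈ Finset.range N, |h (2 ^ k * y)| ≤ 4 * C := by
  have hC : 0 ≤ C := by simpa using (abs_nonneg _).trans (h1 1)
  induction N with
  | zero => simpa using hC
  | succ N ih =>
    rcases le_or_gt |2 ^ N * y| 2 with hy | hy
    · calc ∑ k ∈ Finset.range (N + 1), |h (2 ^ k * y)|
          ≤ ∑ k ∈ Finset.range (N + 1), 2 ^ k * (C * |y|) := by
            refine Finset.sum_le_sum fun k _ => (h1 _).trans_eq ?_
            rw [abs_mul, abs_of_pos (by positivity : (0 : ℝ) < 2 ^ k)]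
            ring
        _ = (2 ^ (N + 1) - 1) * (C * |y|) := by
            rw [← Finset.sum_mul, geom_sum_eq (by norm_num)]
            norm_num
        _ ≤ 4 * C := by
            rw [abs_mul, abs_of_pos (by positivity : (0 : ℝ) < 2 ^ N)] at hy
            have := mul_le_mul_of_nonneg_left hy hC
            have := mul_nonneg hC (abs_nonneg y)
            rw [pow_succ]
            nlinarith
    · rw [Finset.sum_range_succ, h2 _ hy, abs_zero, add_zero]
      exact ih

theorem sum_half_pow_le (N : ℕ) : ∑ k ∈ Finset.range N, ((2 : ℝ) ^ k)⁻¹ ≤ 2 := by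
  have := sum_geometric_two_le N
  simpa using this

/-! ### The family of counterexamples -/

/-- Lacunary Schwartz functions whose Laplacians share one `L^p` majorant in the first variable and
whose mixed derivatives are lacunary sine sums of arbitrary length near the `x`-axis. -/
theorem exists_lacunary_schwartzMap (𝕜 : Type*) [RCLike 𝕜] :
    ∃ G : ℝ → ℝ, (∀ p : ℝ≥0∞, MemLp G p volume) ∧
      ∀ N : ℕ, ∃ u : 𝓢(EuclideanSpace ℝ (Fin 2), 𝕜),
        (∀ v, ‖(Δ u) v‖ ≤ G (v 0)) ∧
        ∃ δ > 0, ∀ x y, |x| < 7 → |y| < δ →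
          (∂_{(EuclideanSpace.single 0 1 : EuclideanSpace ℝ (Fin 2))}
            (∂_{(EuclideanSpace.single 1 1 : EuclideanSpace ℝ (Fin 2))} u)) !₂[x, y] =
            ((-lacunarySin N x : ℝ) : 𝕜) := by
  obtain ⟨ψ, ψ₁, ψ₂, B, C, hψ, hdψ, hdψ₁, hψ₁, hψ0, hB, hC, hψ2⟩ := exists_odd_profile
  -- The radius `7` exceeds `2π`, so `φ = 1` on a full period.
  obtain ⟨φ, hφ, hφ1, hφ0⟩ := exists_contDiff_cutoff (r := 7) (R := 8) (by norm_num) (by norm_num)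
  have hφ' : ContDiff ℝ (⊤ : ℕ∞) (deriv φ) := (contDiff_infty_iff_deriv.1 hφ).2
  have hφ'' : ContDiff ℝ (⊤ : ℕ∞) (deriv (deriv φ)) := (contDiff_infty_iff_deriv.1 hφ').2
  have hdφ (x : ℝ) : HasDerivAt φ (deriv φ x) x := (hφ.differentiable (by simp) x).hasDerivAt
  have hdφ' (x : ℝ) : HasDerivAt (deriv φ) (deriv (deriv φ) x) x :=
    (hφ'.differentiable (by simp) x).hasDerivAt
  have hcs : HasCompactSupport φ := by
    refine HasCompactSupport.intro (isCompact_closedBall (0 : ℝ) 8) fun t ht => hφ0 t ?_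
    simpa using (lt_of_not_ge fun h => ht (by simpa using h)).le
  have hφ1' (x : ℝ) (hx : |x| < 7) : deriv φ x = 0 := by
    have : φ =ᶠ[nhds x] fun _ => 1 := Filter.eventuallyEq_of_mem
      ((isOpen_lt continuous_abs continuous_const).mem_nhds hx) fun s hs => hφ1 s (le_of_lt hs)
    rw [this.deriv_eq, deriv_const]
  have hB0 : 0 ≤ B := (abs_nonneg _).trans (hB 0)
  let G : ℝ → ℝ := fun x =>
    2 * B * |deriv (deriv φ) x| + 4 * B * |deriv φ x| + 4 * C * |φ x|
  have hmem {f : ℝ → ℝ} (hf : Continuous f) (hfc : HasCompactSupport f) (c : ℝ) (p : ℝ≥0∞) :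
      MemLp (fun x => c * |f x|) p volume :=
    ((hf.memLp_of_hasCompactSupport hfc).norm).const_mul c
  refine ⟨G, fun p => ((hmem hφ''.continuous hcs.deriv.deriv _ p).add
    (hmem hφ'.continuous hcs.deriv _ p)).add (hmem hφ.continuous hcs _ p), fun N => ?_⟩
  obtain ⟨u, hu⟩ := exists_schwartzMap_eq_of_contDiff 𝕜
    (F := fun x y => ∑ k ∈ Finset.range N,
      φ x * Real.cos (2 ^ k * x) * ((4 ^ k)⁻¹ * ψ (2 ^ k * y))) (R := 8)
    (by
      refine ContDiff.sum fun k _ => ?_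
      have := hφ.comp (contDiff_fst (𝕜 := ℝ) (E := ℝ) (F := ℝ))
      have := hψ.comp (f := fun q : ℝ × ℝ => 2 ^ k * q.2) (by fun_prop)
      have := Real.contDiff_cos.comp (n := (⊤ : ℕ∞)) (f := fun q : ℝ × ℝ => 2 ^ k * q.1)
        (by fun_prop)
      simp only [Function.comp_def] at *
      fun_prop)
    (fun x y hx => by simp [hφ0 x hx])
    (fun x y hy => Finset.sum_eq_zero fun k _ => by
      have h1 : (1 : ℝ) ≤ 2 ^ k := one_le_pow₀ one_le_two
      have : 2 ≤ |2 ^ k * y| := by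
        rw [abs_mul, abs_of_pos (by positivity : (0 : ℝ) < 2 ^ k)]
        nlinarith
      simp [hψ0 _ this])
  have hcos (k : ℕ) (x : ℝ) :
      HasDerivAt (fun x => Real.cos (2 ^ k * x)) (-Real.sin (2 ^ k * x) * 2 ^ k) x := by
    simpa using ((hasDerivAt_id x).const_mul ((2 : ℝ) ^ k)).cos
  have hsin (k : ℕ) (x : ℝ) :
      HasDerivAt (fun x => Real.sin (2 ^ k * x)) (Real.cos (2 ^ k * x) * 2 ^ k) x := by
    simpa using ((hasDerivAt_id x).const_mul ((2 : ℝ) ^ k)).sin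
  have hscale {f f' : ℝ → ℝ} (hf : ∀ t, HasDerivAt f (f' t) t) (k : ℕ) (y : ℝ) :
      HasDerivAt (fun y => f (2 ^ k * y)) (f' (2 ^ k * y) * 2 ^ k) y := by
    simpa [Function.comp_def] using (hf (2 ^ k * y)).comp y ((hasDerivAt_id y).const_mul ((2 : ℝ) ^ k))
  have h4 (k : ℕ) : (4 : ℝ) ^ k = 2 ^ k * 2 ^ k := by rw [← mul_pow]; norm_num
  have hy := lineDeriv_snd_apply hu
    (F := fun x y => ∑ k ∈ Finset.range N,
      φ x * Real.cos (2 ^ k * x) * ((4 ^ k)⁻¹ * ψ (2 ^ k * y)))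
    (F' := fun x y => ∑ k ∈ Finset.range N,
      φ x * Real.cos (2 ^ k * x) * ((2 ^ k)⁻¹ * ψ₁ (2 ^ k * y))) (by
    intro x y
    refine HasDerivAt.fun_sum fun k _ => ?_
    refine (((hscale hdψ k y).const_mul _).const_mul _).congr_deriv ?_
    rw [h4]; field_simp)
  have hyy := lineDeriv_snd_apply hy
    (F := fun x y => ∑ k ∈ Finset.range N,
      φ x * Real.cos (2 ^ k * x) * ((2 ^ k)⁻¹ * ψ₁ (2 ^ k * y)))
    (F' := fun x y => ∑ k ∈ Finset.range N,
      φ x * Real.cos (2 ^ k * x) * ψ₂ (2 ^ k * y)) (by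
    intro x y
    refine HasDerivAt.fun_sum fun k _ => ?_
    refine (((hscale hdψ₁ k y).const_mul _).const_mul _).congr_deriv ?_
    field_simp)
  have hxy := lineDeriv_fst_apply hy
    (F := fun x y => ∑ k ∈ Finset.range N,
      φ x * Real.cos (2 ^ k * x) * ((2 ^ k)⁻¹ * ψ₁ (2 ^ k * y)))
    (F' := fun x y => ∑ k ∈ Finset.range N,
      (deriv φ x * Real.cos (2 ^ k * x) + φ x * (-Real.sin (2 ^ k * x) * 2 ^ k)) *
        ((2 ^ k)⁻¹ * ψ₁ (2 ^ k * y))) (by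
    intro x y
    refine HasDerivAt.fun_sum fun k _ => ((hdφ x).mul (hcos k x)).mul_const _)
  have hx := lineDeriv_fst_apply hu
    (F := fun x y => ∑ k ∈ Finset.range N,
      φ x * Real.cos (2 ^ k * x) * ((4 ^ k)⁻¹ * ψ (2 ^ k * y)))
    (F' := fun x y => ∑ k ∈ Finset.range N,
      (deriv φ x * Real.cos (2 ^ k * x) + φ x * (-Real.sin (2 ^ k * x) * 2 ^ k)) *
        ((4 ^ k)⁻¹ * ψ (2 ^ k * y))) (by
    intro x y
    refine HasDerivAt.fun_sum fun k _ => ((hdφ x).mul (hcos k x)).mul_const _)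
  have hxx := lineDeriv_fst_apply hx
    (F := fun x y => ∑ k ∈ Finset.range N,
      (deriv φ x * Real.cos (2 ^ k * x) + φ x * (-Real.sin (2 ^ k * x) * 2 ^ k)) *
        ((4 ^ k)⁻¹ * ψ (2 ^ k * y)))
    (F' := fun x y => ∑ k ∈ Finset.range N,
      (deriv (deriv φ) x * Real.cos (2 ^ k * x) + deriv φ x * (-Real.sin (2 ^ k * x) * 2 ^ k) +
        (deriv φ x * (-Real.sin (2 ^ k * x) * 2 ^ k) +
          φ x * (-(Real.cos (2 ^ k * x) * 2 ^ k) * 2 ^ k))) *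
        ((4 ^ k)⁻¹ * ψ (2 ^ k * y))) (by
    intro x y
    refine HasDerivAt.fun_sum fun k _ => (((hdφ' x).mul (hcos k x)).add
      ((hdφ x).mul ((hsin k x).neg.mul_const _))).mul_const _)
  -- For `|y| < 2^{-N}` every `2 ^ k * y` with `k < N` lies where `ψ₁ = 1`.
  refine ⟨u, fun v => ?_, ((2 : ℝ) ^ N)⁻¹, by positivity, fun x y hx hy => ?_⟩
  · rw [laplacian_apply_eq_lineDeriv, hxx, hyy, ← RCLike.ofReal_add, RCLike.norm_ofReal,
      ← Finset.sum_add_distrib]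
    generalize v 0 = x
    generalize v 1 = y
    calc _ ≤ ∑ k ∈ Finset.range N, (B * |deriv (deriv φ) x| * (2 ^ k)⁻¹ +
          2 * B * |deriv φ x| * (2 ^ k)⁻¹ + |φ x| * |ψ₂ (2 ^ k * y) - ψ (2 ^ k * y)|) := by
          refine (Finset.abs_sum_le_sum_abs _ _).trans (Finset.sum_le_sum fun k _ => ?_)
          have hc := Real.abs_cos_le_one (2 ^ k * x)
          have hs := Real.abs_sin_le_one (2 ^ k * x)
          have hb := hB (2 ^ k * y)
          have hk : ((2 : ℝ) ^ k)⁻¹ ≤ 1 := inv_le_one_of_one_le₀ (one_le_pow₀ one_le_two)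
          have hk0 : (0 : ℝ) ≤ (2 ^ k)⁻¹ := by positivity
          -- Two `x`-derivatives of the cosine produce `-4 ^ k`, which cancels `4^{-k}` and pairs
          -- `-ψ` with `ψ₂`.
          have e : (deriv (deriv φ) x * Real.cos (2 ^ k * x) +
              deriv φ x * (-Real.sin (2 ^ k * x) * 2 ^ k) +
              (deriv φ x * (-Real.sin (2 ^ k * x) * 2 ^ k) +
                φ x * (-(Real.cos (2 ^ k * x) * 2 ^ k) * 2 ^ k))) *
              ((4 ^ k)⁻¹ * ψ (2 ^ k * y)) + φ x * Real.cos (2 ^ k * x) * ψ₂ (2 ^ k * y) =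
              ψ (2 ^ k * y) * deriv (deriv φ) x * (2 ^ k)⁻¹ * (Real.cos (2 ^ k * x) * (2 ^ k)⁻¹) +
              2 * -ψ (2 ^ k * y) * deriv φ x * (2 ^ k)⁻¹ * Real.sin (2 ^ k * x) +
              φ x * (ψ₂ (2 ^ k * y) - ψ (2 ^ k * y)) * Real.cos (2 ^ k * x) := by
            rw [h4]; field_simp; ring
          rw [e]
          refine (abs_add_three _ _ _).trans (add_le_add (add_le_add ?_ ?_) ?_)
          · rw [abs_mul, abs_mul, abs_mul, abs_of_nonneg hk0, abs_mul, abs_of_nonneg hk0]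
            calc _ ≤ B * |deriv (deriv φ) x| * (2 ^ k)⁻¹ * (1 * 1) := by gcongr
              _ = _ := by ring
          · rw [abs_mul, abs_mul, abs_mul, abs_mul, abs_of_nonneg hk0, abs_neg, abs_two]
            calc _ ≤ 2 * B * |deriv φ x| * (2 ^ k)⁻¹ * 1 := by gcongr
              _ = _ := by ring
          · rw [abs_mul, abs_mul]
            exact mul_le_of_le_one_right (by positivity) hc
      _ = B * |deriv (deriv φ) x| * ∑ k ∈ Finset.range N, ((2 : ℝ) ^ k)⁻¹ +
          2 * B * |deriv φ x| * ∑ k ∈ Finset.range N, ((2 : ℝ) ^ k)⁻¹ +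
          |φ x| * ∑ k ∈ Finset.range N, |ψ₂ (2 ^ k * y) - ψ (2 ^ k * y)| := by
          simp only [Finset.sum_add_distrib, Finset.mul_sum]
      _ ≤ B * |deriv (deriv φ) x| * 2 + 2 * B * |deriv φ x| * 2 + |φ x| * (4 * C) := by
          have := sum_half_pow_le N
          have := sum_dyadic_dilates_le (h := fun t => ψ₂ t - ψ t) hC hψ2 N y
          gcongr
      _ = G x := by ring
  · rw [hxy]
    congr 1
    simp only [lacunarySin, ← Finset.sum_neg_distrib]
    refine Finset.sum_congr rfl fun k hk => ?_
    have hk : |2 ^ k * y| < 1 := by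
      rw [abs_mul, abs_of_pos (by positivity : (0 : ℝ) < 2 ^ k)]
      calc (2 : ℝ) ^ k * |y| ≤ 2 ^ N * |y| := by
            gcongr
            · norm_num
            · exact (Finset.mem_range.1 hk).le
        _ < 2 ^ N * (2 ^ N)⁻¹ := by gcongr
        _ = 1 := mul_inv_cancel₀ (by positivity)
    simp [hψ₁ _ hk, hφ1 x hx.le, hφ1' x hx]

/-- Here `EuclideanSpace.single 0 1` and `EuclideanSpace.single 1 1` are the coordinate directions
of `x` and `y`, so the left side is the mixed norm of `∂_x ∂_y u`. -/
theorem corollary2p6 {𝕜 : Type*} [RCLike 𝕜] (p : ℝ≥0∞) (hp : 2 ≤ p) :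
    ¬ ∃ C : ℝ≥0, ∀ u : 𝓢(EuclideanSpace ℝ (Fin 2), 𝕜),
      normLinftyYLpX p
          (∂_{(EuclideanSpace.single 0 1 : EuclideanSpace ℝ (Fin 2))}
            (∂_{(EuclideanSpace.single 1 1 : EuclideanSpace ℝ (Fin 2))} u) :
              𝓢(EuclideanSpace ℝ (Fin 2), 𝕜)) ≤
        (C : ℝ≥0∞) * normLpXLinftyY p (Δ u : 𝓢(EuclideanSpace ℝ (Fin 2), 𝕜)) := by
  rintro ⟨C, hC⟩
  obtain ⟨G, hG, hN⟩ := exists_lacunary_schwartzMap 𝕜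
  set μ : Measure ℝ := volume.restrict (Set.Ioc 0 (2 * Real.pi)) with hμ
  -- The Hölder constant between `L²` and `L^p` on a period. For `p = ∞`, `p.toReal = 0` and `1 / 0
  -- = 0` give the correct exponent `1/2`.
  set D : ℝ≥0∞ := μ Set.univ ^ (1 / (2 : ℝ≥0∞).toReal - 1 / p.toReal) with hD
  have hDtop : D ≠ ∞ := by
    refine ENNReal.rpow_ne_top_of_nonneg ?_ (by rw [hμ]; exact measure_ne_top _ _)
    rcases eq_or_ne p ∞ with rfl | hp'
    · simp
    · have h2 : (2 : ℝ≥0∞).toReal ≤ p.toReal := ENNReal.toReal_mono hp' hp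
      exact sub_nonneg.2 (one_div_le_one_div_of_le (by simp) h2)
  set K : ℝ≥0∞ := (C * eLpNorm G p volume * D) ^ 2 with hK
  have hKtop : K ≠ ∞ := ENNReal.pow_ne_top
    (ENNReal.mul_ne_top (ENNReal.mul_ne_top ENNReal.coe_ne_top (hG p).eLpNorm_ne_top) hDtop)
  have hbound (N : ℕ) : ENNReal.ofReal (N * Real.pi) ≤ K := by
    obtain ⟨u, hu, δ, hδ, hxy⟩ := hN N
    rw [← eLpNorm_two_lacunarySin_sq, hK]
    gcongr
    refine (eLpNorm_le_eLpNorm_mul_rpow_measure_univ hp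
      (continuous_lacunarySin N).aestronglyMeasurable).trans ?_
    gcongr
    refine le_trans ?_ ((hC u).trans ?_)
    · unfold normLinftyYLpX
      rw [eLpNorm_exponent_top]
      have hae := enorm_ae_le_eLpNormEssSup (fun y : ℝ => eLpNorm (fun x : ℝ =>
        (∂_{(EuclideanSpace.single 0 1 : EuclideanSpace ℝ (Fin 2))}
          (∂_{(EuclideanSpace.single 1 1 : EuclideanSpace ℝ (Fin 2))} u)) !₂[x, y]) p volume)
        volume
      -- The strip `|y| < δ` has positive measure, so it contains a `y` whose slice norm is at most
      -- the essential supremum.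
      obtain ⟨y, hy, hyδ⟩ : ∃ y, _ ∧ |y| < δ := by
        have hf : ∃ᵐ y : ℝ, |y| < δ := by
          rw [frequently_ae_iff]
          exact ((isOpen_lt continuous_abs continuous_const).measure_pos volume
            ⟨0, by simpa using hδ⟩).ne'
        exact (hf.and_eventually hae).exists.imp fun y h => ⟨h.2, h.1⟩
      refine le_trans ?_ hy
      rw [enorm_eq_self]
      refine le_trans ?_ (eLpNorm_mono_measure _
        (Measure.restrict_le_self (s := Set.Ioc 0 (2 * Real.pi))))
      refine eLpNorm_mono_ae ?_
      refine (ae_restrict_mem measurableSet_Ioc).mono fun x hx => ?_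
      have hx7 : |x| < 7 := by
        rw [abs_of_pos hx.1]
        linarith [hx.2, Real.pi_lt_d2]
      rw [hxy x y hx7 hyδ, RCLike.norm_ofReal, abs_neg, Real.norm_eq_abs]
    · unfold normLpXLinftyY
      gcongr
      refine eLpNorm_mono_enorm fun x => ?_
      rw [enorm_eq_self, eLpNorm_exponent_top]
      refine eLpNormEssSup_le_of_ae_enorm_bound (Filter.Eventually.of_forall fun y => ?_)
      refine enorm_le_iff_norm_le.2 ?_
      exact (hu !₂[x, y]).trans (le_abs_self _)
  obtain ⟨N, hN'⟩ := exists_nat_gt K.toReal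
  have h1 := (ENNReal.ofReal_le_iff_le_toReal hKtop).1 (hbound N)
  nlinarith [Real.pi_gt_three, (Nat.cast_nonneg N : (0 : ℝ) ≤ N)]
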